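/- A $C^\infty$-ring is a set $\mathscr A$ with an operation $g_{\mathscr A}:\mathscr A^m\to\mathscr A$ for every $m\ge 0$ and every $g\in C^\infty(\mathbb R^m)$, compatible with composition of smooth functions and sending each coordinate function to the corresponding projection; maps of $C^\infty$-rings preserve all operations. Every $C^\infty$-ring has an underlying commutative $\mathbb R$-algebra. It is local if it has a unique maximal ideal and the residue field is $\mathbb R$, and germ determined if it embeds into a product of local $C^\infty$-rings. An $\mathbb R$-point of $\mathscr A$ is a map of $C^\infty$-rings $x:\mathscr A\to\mathbb R$; $X_{\mathscr A}$ is the set of all $\mathbb R$-points with the topology generated by the sets $\{x\mid x(a)\neq 0\}$, $a\in\mathscr A$, and $\pi_x:\mathscr A\to\mathscr A_x$ is the localization of $\mathscr A$ at $\{a\mid x(a)\ne 0\}$; explicitly $\mathscr A_x=\mathscr A/I_x$ with $I_x=\{a\mid ad=0\text{ for some } d \text{ with } x(d)\neq 0\}$. The affine scheme $\mathrm{Spec}(\mathscr A)$ is $X_{\mathscr A}$ with the sheaf of $C^\infty$-rings $\mathcal O_{\mathscr A}$ whose sections over an open set $U$ are the maps $s:U\to\bigsqcup_{x\in U}\mathscr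 A_x$, $s(x)\in\mathscr A_x$, that are locally of the form $x\mapsto\pi_x(a)$ with $a\in\mathscr A$; its stalks are the local $C^\infty$-rings $\mathscr A_x$. A morphism $(X,\mathcal O_X)\to(Y,\mathcal O_Y)$ of local $C^\infty$-ringed spaces is a pair $(\varphi,\varphi_\#)$ with $\varphi:X\to Y$ continuous and $\varphi_\#:\mathcal O_Y\to\varphi_*\mathcal O_X$ a map of sheaves of $C^\infty$-rings. **Theorem.** Let $\mathscr A$ be a finitely generated and germ determined $C^\infty$-ring, let $\Pi:C^\infty(\mathbb R^n)\to\mathscr A$ be a surjective map of $C^\infty$-rings, $J=\ker\Pi$, and $Z_J=\{p\in\mathbb R^n\mid j(p)=0\text{ for all }j\in J\}$. Let $L$ be a smooth finite-dimensional second countable Hausdorff manifold, possibly with boundary. Then $$L\to X_{C^\infty(L)},\quad q\mapsto \mathrm{ev}_q,\ \mathrm{ev}_q(h)=h(q),\qquad\text{and}\qquad Z_J\to X_{\mathscr A},\quad p\mapsto\overline{\mathrm{ev}}_p,\ \overline{\mathrm{ev}}_p(\Pi(h))=h(p),$$ are homeomorphisms, and, when these are used to identify $L$ with $X_{C^\infty(L)}$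 and $Z_J$ with $X_{\mathscr A}$, the map $$\Psi:\mathrm{Hom}(\mathrm{Spec}(C^\infty(L)),\mathrm{Spec}(\mathscr A))\to\{f:L\to\mathbb R^n\mid f\text{ is }C^\infty\text{ and }f(L)\subseteq Z_J\},\qquad \Psi((\varphi,\varphi_\#))=\varphi,$$ where $\mathrm{Hom}$ is the set of morphisms of local $C^\infty$-ringed spaces, is well defined and a bijection. That is, $\varphi(\mathrm{ev}_q)=\overline{\mathrm{ev}}_{f(q)}$ for all $q\in L$, where $f=\Psi((\varphi,\varphi_\#))$. -/

import Mathlib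

open scoped Manifold ContDiff
open CategoryTheory TopologicalSpace

universe u v w

noncomputable section

/-! ### Smooth functions -/

/-- `C^∞(M)`: the smooth real-valued functions on `M`. -/
abbrev SmoothFun {E : Type*} [NormedAddCommGroup E] [NormedSpace ℝ E]
    {H : Type*} [TopologicalSpace H] (I : ModelWithCorners ℝ E H)
    (M : Type*) [TopologicalSpace M] [ChartedSpace H M] : Type _ :=
  C^∞⟮I, M; 𝓘(ℝ, ℝ), ℝ⟯

/-- `C^∞(ℝⁿ)`. -/
abbrev EucFun (n : ℕ) : Type := SmoothFun 𝓘(ℝ, Fin n → ℝ) (Fin n → ℝ)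

/-- A smooth function on `ℝⁿ` from a `ContDiff` function. -/
def EucFun.mk {n : ℕ} (f : (Fin n → ℝ) → ℝ) (hf : ContDiff ℝ ∞ f) : EucFun n :=
  ⟨f, hf.contMDiff⟩

@[simp] theorem EucFun.mk_apply {n : ℕ} (f : (Fin n → ℝ) → ℝ) (hf : ContDiff ℝ ∞ f)
    (x : Fin n → ℝ) : EucFun.mk f hf x = f x := rfl

/-- The `i`-th coordinate function on `ℝⁿ`. -/
def EucFun.coord {n : ℕ} (i : Fin n) : EucFun n :=
  EucFun.mk (fun x => x i) (contDiff_apply ℝ ℝ i)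

@[simp] theorem EucFun.coord_apply {n : ℕ} (i : Fin n) (x : Fin n → ℝ) :
    EucFun.coord i x = x i := rfl

section
variable {E : Type*} [NormedAddCommGroup E] [NormedSpace ℝ E]
  {H : Type*} [TopologicalSpace H] {I : ModelWithCorners ℝ E H}
  {M : Type*} [TopologicalSpace M] [ChartedSpace H M]

/-- The smooth function `g ∘ (f₁, …, f_m)`. -/
def SmoothFun.compTuple {m : ℕ} (g : EucFun m) (f : Fin m → SmoothFun I M) : SmoothFun I M :=
  ⟨fun x => g fun i => f i x, g.contMDiff.comp (contMDiff_pi_space.2 fun i => (f i).contMDiff)⟩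

@[simp] theorem SmoothFun.compTuple_apply {m : ℕ} (g : EucFun m) (f : Fin m → SmoothFun I M)
    (x : M) : SmoothFun.compTuple g f x = g fun i => f i x := rfl

end

/-! ### `C^∞`-rings -/

/-- A `C^∞`-ring: a set with an operation `Aⁿ → A` for each `g ∈ C^∞(ℝⁿ)`, compatible with
composition and coordinate functions. The underlying commutative ring is recorded together with
the operations; it is determined by them, its addition and multiplication being the operations
of the functions `x₀ + x₁` and `x₀ x₁`. -/
class CInfRing (A : Type u) extends CommRing A where
  op : ∀ {n : ℕ}, EucFun n → (Fin n → A) → A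
  op_coord : ∀ {n : ℕ} (i : Fin n) (a : Fin n → A), op (EucFun.coord i) a = a i
  op_comp : ∀ {m n : ℕ} (g : EucFun m) (f : Fin m → EucFun n) (a : Fin n → A),
    op (SmoothFun.compTuple g f) a = op g fun i => op (f i) a
  op_add : ∀ a : Fin 2 → A, op (EucFun.coord 0 + EucFun.coord 1) a = a 0 + a 1
  op_mul : ∀ a : Fin 2 → A, op (EucFun.coord 0 * EucFun.coord 1) a = a 0 * a 1


/-- A map of `C^∞`-rings: a map of sets preserving all the operations. -/
@[ext] structure CInfHom (A : Type u) (B : Type v) [CInfRing A] [CInfRing B] where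
  toFun : A → B
  map_op' : ∀ {n : ℕ} (g : EucFun n) (a : Fin n → A),
    toFun (CInfRing.op g a) = CInfRing.op g fun i => toFun (a i)

instance {A : Type u} {B : Type v} [CInfRing A] [CInfRing B] : FunLike (CInfHom A B) A B where
  coe := CInfHom.toFun
  coe_injective := fun _ _ h => CInfHom.ext h

namespace CInfRing

/-- `ℝ` as a `C^∞`-ring. -/
instance instReal : CInfRing ℝ where
  op g a := g a
  op_coord _ _ := rfl
  op_comp _ _ _ := rfl
  op_add _ := rfl
  op_mul _ := rfl

/-- `C^∞(M)` as a `C^∞`-ring: the operations are given by composition. -/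
instance instSmoothFun {E : Type*} [NormedAddCommGroup E] [NormedSpace ℝ E]
    {H : Type*} [TopologicalSpace H] {I : ModelWithCorners ℝ E H}
    {M : Type*} [TopologicalSpace M] [ChartedSpace H M] : CInfRing (SmoothFun I M) where
  op g a := SmoothFun.compTuple g a
  op_coord _ _ := rfl
  op_comp _ _ _ := rfl
  op_add _ := rfl
  op_mul _ := rfl

/-- Products of `C^∞`-rings, with the pointwise operations. -/
instance instPi {ι : Type v} (S : ι → Type w) [∀ i, CInfRing (S i)] :
    CInfRing (∀ i, S i) where
  op g a := fun i => op g fun k => a k i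
  op_coord k _ := funext fun _ => op_coord k _
  op_comp g f _ := funext fun _ => op_comp g f _
  op_add _ := funext fun _ => op_add _
  op_mul _ := funext fun _ => op_mul _

variable {A : Type u} [CInfRing A]

/-- Identities between smooth functions hold between the operations. -/
theorem op_congr_comp {m n : ℕ} {h : EucFun n} (g : EucFun m) (f : Fin m → EucFun n)
    (hh : ∀ x, h x = g fun i => f i x) (a : Fin n → A) :
    op h a = op g fun i => op (f i) a := by
  rw [← op_comp]
  congr 1
  ext x
  exact hh x

theorem op_add' {n : ℕ} {h f g : EucFun n} (hh : ∀ x, h x = f x + g x) (a : Fin n → A) :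
    op h a = op f a + op g a := by
  rw [op_congr_comp (EucFun.coord 0 + EucFun.coord 1 : EucFun 2) ![f, g] (fun x => hh x), op_add]
  rfl

theorem op_mul' {n : ℕ} {h f g : EucFun n} (hh : ∀ x, h x = f x * g x) (a : Fin n → A) :
    op h a = op f a * op g a := by
  rw [op_congr_comp (EucFun.coord 0 * EucFun.coord 1 : EucFun 2) ![f, g] (fun x => hh x), op_mul]
  rfl

theorem op_zero {n : ℕ} {h : EucFun n} (hh : ∀ x, h x = 0) (a : Fin n → A) : op h a = 0 := by
  have := op_add' (h := h) (f := h) (g := h) (fun x => by simp [hh x]) a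
  simpa using this

theorem op_one {n : ℕ} {h : EucFun n} (hh : ∀ x, h x = 1) (a : Fin n → A) : op h a = 1 := by
  -- first for one variable, where the coordinate function is available
  have key : ∀ (k : EucFun 0), (∀ x, k x = 1) → ∀ b : Fin 0 → A, op k b = 1 := by
    intro k hk b
    have h1 : ∀ c : A, op k b * c = c := by
      intro c
      have e1 : op (EucFun.mk (n := 1) (fun _ => 1) contDiff_const) (fun _ => c) = op k b := by
        rw [op_congr_comp k Fin.elim0 (fun x => (hk _).symm)]
        congr 1
        exact Subsingleton.elim _ _
      have e2 := op_mul' (A := A) (n := 1) (h := EucFun.coord 0)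
        (f := EucFun.mk (n := 1) (fun _ => 1) contDiff_const) (g := EucFun.coord 0)
        (fun x => by simp) (fun _ => c)
      rw [e1, op_coord] at e2
      exact e2.symm
    simpa using h1 1
  rw [op_congr_comp (EucFun.mk (n := 0) (fun _ => 1) contDiff_const) Fin.elim0
    (fun x => by simp [hh x])]
  exact key _ (fun _ => rfl) _

/-- The scalar `c`, as a nullary operation. -/
def scalar (A : Type u) [CInfRing A] (c : ℝ) : A :=
  op (EucFun.mk (n := 0) (fun _ => c) contDiff_const) Fin.elim0

theorem op_const {n : ℕ} {h : EucFun n} {c : ℝ} (hh : ∀ x, h x = c) (a : Fin n → A) :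
    op h a = scalar A c := by
  rw [op_congr_comp (EucFun.mk (n := 0) (fun _ => c) contDiff_const) Fin.elim0
    (fun x => by simp [hh x]), scalar]
  congr 1
  exact Subsingleton.elim _ _

end CInfRing

namespace CInfHom
open CInfRing

variable {A : Type u} {B : Type v} {C : Type w} [CInfRing A] [CInfRing B] [CInfRing C]

theorem map_op (φ : CInfHom A B) {n : ℕ} (g : EucFun n) (a : Fin n → A) :
    φ (op g a) = op g fun i => φ (a i) := φ.map_op' g a

/-- The identity map. -/
def id (A : Type u) [CInfRing A] : CInfHom A A := ⟨fun a => a, fun _ _ => rfl⟩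

/-- The composite `ψ ∘ φ`. -/
def comp (ψ : CInfHom B C) (φ : CInfHom A B) : CInfHom A C :=
  ⟨fun a => ψ (φ a), fun g a => by rw [map_op, map_op]⟩

@[simp] theorem id_apply (a : A) : CInfHom.id A a = a := rfl
@[simp] theorem comp_apply (ψ : CInfHom B C) (φ : CInfHom A B) (a : A) :
    ψ.comp φ a = ψ (φ a) := rfl

/-- The underlying map of rings. -/
def toRingHom (φ : CInfHom A B) : A →+* B where
  toFun := φ
  map_one' := by
    have h := φ.map_op (EucFun.mk (n := 0) (fun _ => 1) contDiff_const) Fin.elim0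
    rwa [op_one (fun _ => rfl), op_one (fun _ => rfl)] at h
  map_zero' := by
    have h := φ.map_op (EucFun.mk (n := 0) (fun _ => 0) contDiff_const) Fin.elim0
    rwa [op_zero (fun _ => rfl), op_zero (fun _ => rfl)] at h
  map_add' a b := by
    have h := φ.map_op (EucFun.coord 0 + EucFun.coord 1) ![a, b]
    rw [CInfRing.op_add, CInfRing.op_add] at h
    exact h
  map_mul' a b := by
    have h := φ.map_op (EucFun.coord 0 * EucFun.coord 1) ![a, b]
    rw [CInfRing.op_mul, CInfRing.op_mul] at h
    exact h

@[simp] theorem toRingHom_apply (φ : CInfHom A B) (a : A) : φ.toRingHom a = φ a := rfl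

instance : RingHomClass (CInfHom A B) A B where
  map_one φ := φ.toRingHom.map_one
  map_zero φ := φ.toRingHom.map_zero
  map_add φ := φ.toRingHom.map_add
  map_mul φ := φ.toRingHom.map_mul

theorem map_scalar (φ : CInfHom A B) (c : ℝ) : φ (scalar A c) = scalar B c := by
  rw [scalar, map_op]
  exact op_const (fun _ => rfl) _

/-- The map `C^∞(ℝⁿ) → A` sending the coordinate functions to `a₁, …, aₙ`. -/
def ofTuple {n : ℕ} (a : Fin n → A) : CInfHom (EucFun n) A :=
  ⟨fun f => op f a, fun g f => op_comp g f a⟩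

@[simp] theorem ofTuple_apply {n : ℕ} (a : Fin n → A) (f : EucFun n) :
    ofTuple a f = op f a := rfl

end CInfHom

/-- A `C^∞`-ring is local if it has a unique maximal ideal and the residue field is `ℝ`. The
second condition is the existence of an `ℝ`-point: such a point is surjective, so that its kernel
is the maximal ideal. -/
def CInfRing.IsLocal (A : Type u) [CInfRing A] : Prop :=
  IsLocalRing A ∧ Nonempty (CInfHom A ℝ)

/-- A `C^∞`-ring is germ determined if it embeds into a product of local `C^∞`-rings. -/
def CInfRing.GermDetermined (A : Type u) [CInfRing A] : Prop :=
  ∃ (ι : Type u) (S : ι → Type u) (_ : ∀ i, CInfRing (S i)),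
    (∀ i, CInfRing.IsLocal (S i)) ∧ ∃ φ : CInfHom A (∀ i, S i), Function.Injective φ

/-! ### `ℝ`-points and localizations at `ℝ`-points -/

/-- The set `X_A = Hom(A, ℝ)` of `ℝ`-points. -/
abbrev CInfPoint (A : Type u) [CInfRing A] : Type u := CInfHom A ℝ

namespace CInfPoint
open CInfRing

variable {A : Type u} [CInfRing A]

/-- The Zariski topology, with basis the sets `{x | x a ≠ 0}`, `a ∈ A`. -/
instance : TopologicalSpace (CInfPoint A) :=
  TopologicalSpace.generateFrom (Set.range fun a : A => {x : CInfPoint A | x a ≠ 0})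

theorem isOpen_ne_zero (a : A) : IsOpen {x : CInfPoint A | x a ≠ 0} :=
  TopologicalSpace.isOpen_generateFrom_of_mem ⟨a, rfl⟩

@[simp] theorem map_scalar (x : CInfPoint A) (c : ℝ) : x (scalar A c) = c :=
  CInfHom.map_scalar x c

/-- The ideal `I_x` of the elements of `A` whose germ at `x` is zero. -/
def germIdeal (x : CInfPoint A) : Ideal A where
  carrier := {a | ∃ d : A, x d ≠ 0 ∧ a * d = 0}
  zero_mem' := ⟨1, by simp, by simp⟩
  add_mem' := by
    rintro a b ⟨d, hd, had⟩ ⟨e, he, hbe⟩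
    refine ⟨d * e, by simp [hd, he], ?_⟩
    linear_combination e * had + d * hbe
  smul_mem' := by
    rintro c a ⟨d, hd, had⟩
    refine ⟨d, hd, ?_⟩
    rw [smul_eq_mul, mul_assoc, had, mul_zero]

theorem mem_germIdeal {x : CInfPoint A} {a : A} :
    a ∈ germIdeal x ↔ ∃ d : A, x d ≠ 0 ∧ a * d = 0 := Iff.rfl

/-- A cut-off function near `c ≠ 0` and a smooth function inverting the coordinate on its
support. -/
theorem exists_cutoff {c : ℝ} (hc : c ≠ 0) : ∃ χ ρ : ℝ → ℝ, ContDiff ℝ ∞ χ ∧ ContDiff ℝ ∞ ρ ∧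
    χ c = 1 ∧ ∀ s, χ s * (s * ρ s - 1) = 0 := by
  have hpos : ∀ s : ℝ, s ^ 2 + Real.smoothTransition (1 - 2 * s ^ 2 / c ^ 2) ≠ 0 := by
    intro s
    have h0 := Real.smoothTransition.nonneg (1 - 2 * s ^ 2 / c ^ 2)
    rcases eq_or_ne s 0 with rfl | hs
    · simp
    · have := pow_pos (abs_pos.2 hs) 2
      rw [sq_abs] at this
      positivity
  have hT : ContDiff ℝ ∞ Real.smoothTransition := Real.smoothTransition.contDiff
  refine ⟨fun s => Real.smoothTransition (2 * s ^ 2 / c ^ 2 - 1),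
    fun s => s / (s ^ 2 + Real.smoothTransition (1 - 2 * s ^ 2 / c ^ 2)), ?_, ?_, ?_, ?_⟩
  · exact hT.comp (by fun_prop)
  · exact contDiff_id.div ((contDiff_id.pow 2).add (hT.comp (by fun_prop))) hpos
  · have : 2 * c ^ 2 / c ^ 2 - 1 = 1 := by field_simp; norm_num
    simp only [this]
    exact Real.smoothTransition.one
  · intro s
    dsimp only
    rcases le_or_gt (2 * s ^ 2 / c ^ 2 - 1) 0 with h | h
    · rw [Real.smoothTransition.zero_of_nonpos h, zero_mul]
    · rw [Real.smoothTransition.zero_of_nonpos (x := 1 - 2 * s ^ 2 / c ^ 2) (by linarith)]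
      have hs : s ≠ 0 := by
        rintro rfl
        norm_num at h
      field_simp
      ring

/-- The operations of `A` are compatible with congruence modulo `I_x`. -/
theorem op_sub_op_mem (x : CInfPoint A) {n : ℕ} (g : EucFun n) (a b : Fin n → A)
    (h : ∀ i, a i - b i ∈ germIdeal x) : op g a - op g b ∈ germIdeal x := by
  choose d hd hd0 using h
  set D : A := ∏ i, d i with hD
  have hxD : x D ≠ 0 := by
    rw [hD, map_prod]
    exact Finset.prod_ne_zero_iff.2 fun i _ => hd i
  have hD0 : ∀ i, (a i - b i) * D = 0 := by
    intro i
    rw [hD, ← Finset.mul_prod_erase Finset.univ d (Finset.mem_univ i), ← mul_assoc, hd0, zero_mul]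
  obtain ⟨χ, ρ, hχ, hρ, hχ1, hχρ⟩ := exists_cutoff hxD
  let T : Fin (n + n + 1) → A := Fin.snoc (Fin.append a b) D
  let U : Fin n → EucFun (n + n + 1) := fun i => EucFun.coord (Fin.castSucc (Fin.castAdd n i))
  let V : Fin n → EucFun (n + n + 1) := fun i => EucFun.coord (Fin.castSucc (Fin.natAdd n i))
  let s : EucFun (n + n + 1) := EucFun.coord (Fin.last (n + n))
  let X : EucFun 1 := EucFun.mk (fun y => χ (y 0)) (hχ.comp (contDiff_apply ℝ ℝ 0))
  let P : EucFun 1 := EucFun.mk (fun y => ρ (y 0)) (hρ.comp (contDiff_apply ℝ ℝ 0))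
  let Xs : EucFun (n + n + 1) := op X fun _ => s
  let Ps : EucFun (n + n + 1) := op P fun _ => s
  let W : Fin n → EucFun (n + n + 1) := fun i => V i + (U i - V i) * s * Ps
  have hU : ∀ i, CInfHom.ofTuple T (U i) = a i := fun i => by
    simp [U, T, op_coord]
  have hV : ∀ i, CInfHom.ofTuple T (V i) = b i := fun i => by
    rw [CInfHom.ofTuple_apply, op_coord]
    simp only [T, Fin.snoc_castSucc, Fin.append_right]
  have hs : CInfHom.ofTuple T s = D := by
    simp [s, T, op_coord]
  have hW : ∀ i, CInfHom.ofTuple T (W i) = b i := fun i => by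
    simp only [W, map_add, map_mul, map_sub, hU, hV, hs, hD0, zero_mul, add_zero]
  have hfun : (op g U - op g V) * Xs = (op g W - op g V) * Xs := by
    ext y
    change (g (fun i => U i y) - g (fun i => V i y)) * χ (s y)
      = (g (fun i => V i y + (U i y - V i y) * s y * ρ (s y)) - g (fun i => V i y)) * χ (s y)
    rcases mul_eq_zero.1 (hχρ (s y)) with h0 | h1
    · rw [h0, mul_zero, mul_zero]
    · have h2 : ∀ i, V i y + (U i y - V i y) * s y * ρ (s y) = U i y := fun i => by
        linear_combination (U i y - V i y) * h1
      simp only [h2]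
  have key := congrArg (CInfHom.ofTuple T) hfun
  simp only [map_mul, map_sub, CInfHom.map_op, hU, hV, hW, Xs, hs, sub_self, zero_mul] at key
  refine ⟨op X fun _ => D, ?_, key⟩
  rw [CInfHom.map_op]
  change χ (x D) ≠ 0
  rw [hχ1]
  exact one_ne_zero

/-- The ring `A_x = A / I_x` of germs at `x`. -/
abbrev Germ (x : CInfPoint A) : Type u := A ⧸ germIdeal x

theorem mk_op_eq (x : CInfPoint A) {n : ℕ} (g : EucFun n) (a b : Fin n → A)
    (h : ∀ i, (Ideal.Quotient.mk (germIdeal x) (a i)) = Ideal.Quotient.mk (germIdeal x) (b i)) :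
    Ideal.Quotient.mk (germIdeal x) (op g a) = Ideal.Quotient.mk (germIdeal x) (op g b) :=
  Ideal.Quotient.eq.2 (op_sub_op_mem x g a b fun i => Ideal.Quotient.eq.1 (h i))

/-- The operations of `A_x`, induced by those of `A`. -/
def germOp (x : CInfPoint A) {n : ℕ} (g : EucFun n) (a : Fin n → Germ x) : Germ x :=
  Ideal.Quotient.mk (germIdeal x) (op g fun i => Quotient.out (a i))

theorem germOp_mk (x : CInfPoint A) {n : ℕ} (g : EucFun n) (a : Fin n → A) :
    germOp x g (fun i => Ideal.Quotient.mk (germIdeal x) (a i))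
      = Ideal.Quotient.mk (germIdeal x) (op g a) :=
  mk_op_eq x g _ _ fun _ => Quotient.out_eq _

theorem exists_rep (x : CInfPoint A) {n : ℕ} (a : Fin n → Germ x) :
    ∃ b : Fin n → A, a = fun i => Ideal.Quotient.mk (germIdeal x) (b i) :=
  ⟨fun i => Quotient.out (a i), funext fun _ => (Quotient.out_eq _).symm⟩

instance instGerm (x : CInfPoint A) : CInfRing (Germ x) where
  op g a := germOp x g a
  op_coord i a := by
    obtain ⟨b, rfl⟩ := exists_rep x a
    rw [germOp_mk, op_coord]
  op_comp g f a := by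
    obtain ⟨b, rfl⟩ := exists_rep x a
    simp only [germOp_mk, CInfRing.op_comp]
  op_add a := by
    obtain ⟨b, rfl⟩ := exists_rep x a
    rw [germOp_mk, CInfRing.op_add, map_add]
  op_mul a := by
    obtain ⟨b, rfl⟩ := exists_rep x a
    rw [germOp_mk, CInfRing.op_mul, map_mul]

/-- The localization map `π_x : A → A_x`. -/
def toGerm (x : CInfPoint A) : CInfHom A (Germ x) :=
  ⟨fun a => Ideal.Quotient.mk (germIdeal x) a, fun g a => (germOp_mk x g a).symm⟩

theorem toGerm_surjective (x : CInfPoint A) : Function.Surjective (toGerm x) :=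
  Ideal.Quotient.mk_surjective

theorem toGerm_eq_iff {x : CInfPoint A} {a b : A} :
    toGerm x a = toGerm x b ↔ ∃ d : A, x d ≠ 0 ∧ (a - b) * d = 0 :=
  Ideal.Quotient.eq

/-- Elements not vanishing at `x` become invertible in `A_x`. -/
theorem isUnit_toGerm {x : CInfPoint A} {a : A} (ha : x a ≠ 0) : IsUnit (toGerm x a) := by
  obtain ⟨χ, ρ, hχ, hρ, hχ1, hχρ⟩ := exists_cutoff ha
  let X : EucFun 1 := EucFun.mk (fun y => χ (y 0)) (hχ.comp (contDiff_apply ℝ ℝ 0))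
  let P : EucFun 1 := EucFun.mk (fun y => ρ (y 0)) (hρ.comp (contDiff_apply ℝ ℝ 0))
  have hfun : (EucFun.coord 0 * P - 1) * X = 0 := by
    ext y
    change (y 0 * ρ (y 0) - 1) * χ (y 0) = 0
    rw [mul_comm]
    exact hχρ _
  have key := congrArg (CInfHom.ofTuple fun _ => a) hfun
  simp only [map_mul, map_sub, map_one, map_zero, CInfHom.ofTuple_apply, op_coord] at key
  refine IsUnit.of_mul_eq_one (toGerm x (op P fun _ => a)) ?_
  rw [← map_mul, ← map_one (toGerm x), toGerm_eq_iff]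
  refine ⟨op X fun _ => a, ?_, key⟩
  rw [CInfHom.map_op]
  change χ (x a) ≠ 0
  rw [hχ1]
  exact one_ne_zero

/-- A map out of `A` which inverts the elements not vanishing at `x` factors through `A_x`. -/
def liftGerm {B : Type v} [CInfRing B] (x : CInfPoint A) (φ : CInfHom A B)
    (h : ∀ a b, toGerm x a = toGerm x b → φ a = φ b) : CInfHom (Germ x) B where
  toFun s := φ (Quotient.out s)
  map_op' g a := by
    rw [← CInfHom.map_op]
    exact h _ _ (Quotient.out_eq _)

theorem liftGerm_toGerm {B : Type v} [CInfRing B] (x : CInfPoint A) (φ : CInfHom A B)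
    (h : ∀ a b, toGerm x a = toGerm x b → φ a = φ b) (a : A) :
    liftGerm x φ h (toGerm x a) = φ a :=
  h _ _ (Quotient.out_eq _)

/-- `π_x : A → A_x` is the localization of the `C^∞`-ring `A` at `{a | x a ≠ 0}`. -/
theorem germ_universal (x : CInfPoint A) :
    (∀ a, x a ≠ 0 → IsUnit (toGerm x a)) ∧
    ∀ (B : Type v) [CInfRing B] (φ : CInfHom A B), (∀ a, x a ≠ 0 → IsUnit (φ a)) →
      ∃! ψ : CInfHom (Germ x) B, ψ.comp (toGerm x) = φ := by
  refine ⟨fun a ha => isUnit_toGerm ha, fun B _ φ hφ => ?_⟩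
  have h : ∀ a b, toGerm x a = toGerm x b → φ a = φ b := by
    intro a b hab
    obtain ⟨d, hd, h0⟩ := toGerm_eq_iff.1 hab
    have h1 := congrArg φ h0
    rw [map_mul, map_zero, map_sub] at h1
    exact sub_eq_zero.1 ((hφ d hd).mul_left_eq_zero.1 h1)
  refine ⟨liftGerm x φ h, CInfHom.ext (funext fun a => liftGerm_toGerm x φ h a), ?_⟩
  intro ψ hψ
  refine DFunLike.ext _ _ fun s => ?_
  obtain ⟨a, rfl⟩ := toGerm_surjective x s
  rw [liftGerm_toGerm, ← hψ, CInfHom.comp_apply]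

/-- The evaluation `A_x → ℝ` induced by `x`. -/
def germEval (x : CInfPoint A) : CInfHom (Germ x) ℝ :=
  liftGerm x x fun a b hab => by
    obtain ⟨d, hd, h0⟩ := toGerm_eq_iff.1 hab
    have h1 := congrArg x h0
    rw [map_mul, map_zero, map_sub] at h1
    exact sub_eq_zero.1 ((mul_eq_zero.1 h1).resolve_right hd)

@[simp] theorem germEval_toGerm (x : CInfPoint A) (a : A) : germEval x (toGerm x a) = x a :=
  liftGerm_toGerm x x _ a

theorem germ_isLocal (x : CInfPoint A) : CInfRing.IsLocal (Germ x) := by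
  have hunit : ∀ s : Germ x, germEval x s ≠ 0 → IsUnit s := by
    intro s hs
    obtain ⟨a, rfl⟩ := toGerm_surjective x s
    exact isUnit_toGerm (by simpa using hs)
  have : Nontrivial (Germ x) := (germEval x).toRingHom.domain_nontrivial
  refine ⟨IsLocalRing.of_isUnit_or_isUnit_one_sub_self fun s => ?_, ⟨germEval x⟩⟩
  by_cases hs : germEval x s = 0
  · exact Or.inr (hunit _ (by simp [hs]))
  · exact Or.inl (hunit _ hs)

end CInfPoint

/-! ### Local `C^∞`-ringed spaces -/

/-- The category of `C^∞`-rings. -/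
structure CInfRingCat : Type (u + 1) where
  of ::
  carrier : Type u
  [str : CInfRing carrier]

attribute [instance] CInfRingCat.str

instance : CoeSort CInfRingCat.{u} (Type u) := ⟨CInfRingCat.carrier⟩

instance : Category CInfRingCat.{u} where
  Hom A B := CInfHom A B
  id A := CInfHom.id A
  comp φ ψ := ψ.comp φ

/-- A morphism in the category of `C^∞`-rings, as a map of `C^∞`-rings. -/
def CInfRingCat.toHom {A B : CInfRingCat.{u}} (φ : A ⟶ B) : CInfHom A B := φ

/-- A map of `C^∞`-rings, as a morphism in the category of `C^∞`-rings. -/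
def CInfRingCat.ofHom {A B : Type u} [CInfRing A] [CInfRing B] (φ : CInfHom A B) :
    CInfRingCat.of A ⟶ CInfRingCat.of B := φ

/-- The diagram `U ↦ F(U)` of the open neighbourhoods of `x`, whose colimit is the stalk. -/
abbrev stalkDiagram (X : AlgebraicGeometry.SheafedSpace CInfRingCat.{u}) (x : X) :
    (OpenNhds x)ᵒᵖ ⥤ CInfRingCat.{u} :=
  (OpenNhds.inclusion x).op ⋙ X.presheaf

/-- A local `C^∞`-ringed space: a topological space with a sheaf of `C^∞`-rings whose stalks
are local `C^∞`-rings. -/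
structure LocalCInfRingedSpace : Type (u + 1)
    extends AlgebraicGeometry.SheafedSpace CInfRingCat.{u} where
  isLocal : ∀ x : carrier, ∃ c : Limits.Cocone (stalkDiagram toSheafedSpace x),
    Nonempty (Limits.IsColimit c) ∧ CInfRing.IsLocal c.pt

/-- Morphisms of local `C^∞`-ringed spaces are all morphisms `(f, f_#)` of `C^∞`-ringed spaces:
`f` is continuous, and `f_#` is a map of sheaves of `C^∞`-rings from the structure sheaf of the
target to the push-forward of that of the source. -/
instance : Category LocalCInfRingedSpace.{u} :=
  inferInstanceAs (Category (InducedCategory (AlgebraicGeometry.SheafedSpace CInfRingCat.{u})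
    LocalCInfRingedSpace.toSheafedSpace))

/-- The underlying map of points. -/
def LocalCInfRingedSpace.points {X Y : LocalCInfRingedSpace.{u}} (F : X ⟶ Y) :
    X.carrier → Y.carrier :=
  F.hom.hom.base

/-! ### The spectrum of a `C^∞`-ring -/

namespace CInfSpec
open CInfRing CInfPoint

variable (A : Type u) [CInfRing A]

/-- `X_A` with the Zariski topology. -/
abbrev space : TopCat.{u} := TopCat.of (CInfPoint A)

variable {A}

/-- A section of the germs over `U` which is locally of the form `x ↦ π_x(a)`, `a ∈ A`. -/
def IsRegular {U : Opens (CInfPoint A)} (s : ∀ x : U, Germ x.1) : Prop :=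
  ∀ x : U, ∃ V : Opens (CInfPoint A), x.1 ∈ V ∧ ∃ a : A, ∀ y : U, y.1 ∈ V → s y = toGerm y.1 a

theorem isRegular_op {U : Opens (CInfPoint A)} {n : ℕ} (g : EucFun n)
    (s : Fin n → ∀ x : U, Germ x.1) (hs : ∀ i, IsRegular (s i)) : IsRegular (op g s) := by
  intro x
  choose V hxV a ha using fun i => hs i x
  refine ⟨⟨⋂ i, (V i : Set (CInfPoint A)), isOpen_iInter_of_finite fun i => (V i).isOpen⟩,
    Set.mem_iInter.2 hxV, op g a, fun y hy => ?_⟩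
  rw [CInfHom.map_op]
  change op g (fun i => s i y) = _
  congr 1
  exact funext fun i => ha i y (Set.mem_iInter.1 hy i)

theorem isRegular_const {U : Opens (CInfPoint A)} (a : A) :
    IsRegular (fun x : U => toGerm x.1 a) :=
  fun _ => ⟨⊤, trivial, a, fun _ _ => rfl⟩

/-- The sections over `U`, as a ring under the pointwise operations. -/
def sectionsSubring (U : Opens (CInfPoint A)) : Subring (∀ x : U, Germ x.1) where
  carrier := {s | IsRegular s}
  zero_mem' := by
    have h : (fun x : U => toGerm x.1 (0 : A)) = 0 := funext fun x => map_zero _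
    exact h ▸ isRegular_const (U := U) (0 : A)
  one_mem' := by
    have h : (fun x : U => toGerm x.1 (1 : A)) = 1 := funext fun x => map_one _
    exact h ▸ isRegular_const (U := U) (1 : A)
  add_mem' {s t} hs ht := by
    have := isRegular_op (EucFun.coord 0 + EucFun.coord 1) ![s, t]
      (Fin.forall_fin_two.2 ⟨hs, ht⟩)
    rwa [CInfRing.op_add] at this
  mul_mem' {s t} hs ht := by
    have := isRegular_op (EucFun.coord 0 * EucFun.coord 1) ![s, t]
      (Fin.forall_fin_two.2 ⟨hs, ht⟩)
    rwa [CInfRing.op_mul] at this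
  neg_mem' {s} hs := by
    have h1 := isRegular_op (EucFun.coord 0 * EucFun.coord 1) ![fun x => toGerm x.1 (-1), s]
      (Fin.forall_fin_two.2 ⟨isRegular_const _, hs⟩)
    rw [CInfRing.op_mul] at h1
    have h2 : (fun x : U => toGerm x.1 (-1 : A)) * s = -s := by
      ext x
      simp
    exact h2 ▸ h1

/-- The `C^∞`-ring of sections over `U`. -/
abbrev Sections (U : Opens (CInfPoint A)) : Type u := sectionsSubring U

instance (U : Opens (CInfPoint A)) : CInfRing (Sections U) where
  toCommRing := inferInstance
  op g s := ⟨op g fun i => (s i).1, isRegular_op g _ fun i => (s i).2⟩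
  op_coord i _ := Subtype.ext (CInfRing.op_coord i _)
  op_comp g f _ := Subtype.ext (CInfRing.op_comp g f _)
  op_add _ := Subtype.ext (CInfRing.op_add _)
  op_mul _ := Subtype.ext (CInfRing.op_mul _)

/-- The value of a section at a point. -/
def eval {U : Opens (CInfPoint A)} (x : U) : CInfHom (Sections U) (Germ x.1) :=
  ⟨fun s => s.1 x, fun _ _ => rfl⟩

theorem sections_ext {U : Opens (CInfPoint A)} {s t : Sections U}
    (h : ∀ x : U, eval x s = eval x t) : s = t :=
  Subtype.ext (funext h)

/-- Restriction of sections. -/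
def res {U V : Opens (CInfPoint A)} (h : V ≤ U) : CInfHom (Sections U) (Sections V) where
  toFun s := ⟨fun x => s.1 ⟨x.1, h x.2⟩, fun x => by
    obtain ⟨W, hxW, a, ha⟩ := s.2 ⟨x.1, h x.2⟩
    exact ⟨W, hxW, a, fun y hy => ha ⟨y.1, h y.2⟩ hy⟩⟩
  map_op' _ _ := rfl

theorem eval_res {U V : Opens (CInfPoint A)} (h : V ≤ U) (s : Sections U) (x : V) :
    eval x (res h s) = eval (⟨x.1, h x.2⟩ : U) s := rfl

/-- The section `x ↦ π_x(a)` over `U`. -/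
def ofElem (U : Opens (CInfPoint A)) : CInfHom A (Sections U) where
  toFun a := ⟨fun x => toGerm x.1 a, isRegular_const a⟩
  map_op' g a := Subtype.ext (funext fun x => (toGerm x.1).map_op g a)

theorem eval_ofElem {U : Opens (CInfPoint A)} (x : U) (a : A) :
    eval x (ofElem U a) = toGerm x.1 a := rfl

variable (A)

/-- The structure presheaf `U ↦ O_A(U)`. -/
def presheaf : (space A).Presheaf CInfRingCat.{u} where
  obj U := CInfRingCat.of (Sections (A := A) U.unop)
  map i := CInfRingCat.ofHom (res i.unop.le)
  map_id _ := rfl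
  map_comp _ _ := rfl

theorem presheaf_isSheaf : (presheaf A).IsSheaf := by
  intro E U S hS x hx
  -- the value at `y` of the glued section is that of any member of the family defined at `y`
  have hx' : ∀ {V W : Opens (CInfPoint A)} (f : V ⟶ U) (g : W ⟶ U) (hf : S f) (hg : S g)
      (y : CInfPoint A) (hyV : y ∈ V) (hyW : y ∈ W) (e : E),
      eval ⟨y, hyV⟩ (CInfRingCat.toHom (x f hf) e) =
        eval ⟨y, hyW⟩ (CInfRingCat.toHom (x g hg) e) := by
    intro V W f g hf hg y hyV hyW e
    have h := hx (Opens.infLELeft V W) (homOfLE inf_le_right) hf hg (Subsingleton.elim _ _)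
    have h1 := congrArg (fun φ : E ⟶ CInfRingCat.of (Sections (V ⊓ W)) =>
      eval (U := V ⊓ W) ⟨y, ⟨hyV, hyW⟩⟩ (CInfRingCat.toHom φ e)) h
    exact h1
  choose V f hf hyV using fun y : (U : Opens (CInfPoint A)) => hS y.1 y.2
  let val : E → ∀ y : U, Germ (A := A) y.1 := fun e y =>
    eval (U := V y) ⟨y.1, hyV y⟩ (CInfRingCat.toHom (x (f y) (hf y)) e)
  have hval : ∀ {W : Opens (CInfPoint A)} (g : W ⟶ U) (hg : S g) (y : W) (e : E),
      val e ⟨y.1, g.le y.2⟩ = eval y (CInfRingCat.toHom (x g hg) e) :=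
    fun g hg y e => hx' _ _ _ _ _ _ _ _
  have hreg : ∀ e, IsRegular (val e) := by
    intro e y
    obtain ⟨W, hyW, a, ha⟩ := (CInfRingCat.toHom (x (f y) (hf y)) e).2 ⟨y.1, hyV y⟩
    refine ⟨W ⊓ V y, ⟨hyW, hyV y⟩, a, fun z hz => ?_⟩
    exact (hval (f y) (hf y) ⟨z.1, hz.2⟩ e).trans (ha ⟨z.1, hz.2⟩ hz.1)
  let t : CInfHom E (Sections (A := A) U) :=
    { toFun := fun e => ⟨val e, hreg e⟩
      map_op' := fun g a => Subtype.ext (funext fun y => by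
        change val (op g a) y = op g fun i => val (a i) y
        simp only [val, CInfHom.map_op]
        rfl) }
  refine ⟨t, fun W g hg => ?_, fun t' ht' => ?_⟩
  · exact CInfHom.ext (funext fun e => sections_ext fun y => hval g hg y e)
  · refine CInfHom.ext (funext fun e => sections_ext fun y => ?_)
    have h := congrArg (fun φ : E ⟶ CInfRingCat.of (Sections (V y)) =>
      eval ⟨y.1, hyV y⟩ (CInfRingCat.toHom φ e)) (ht' (f y) (hf y))
    exact h

/-- The underlying `C^∞`-ringed space of `Spec(A)`. -/
def sheafedSpace : AlgebraicGeometry.SheafedSpace CInfRingCat.{u} where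
  carrier := space A
  presheaf := presheaf A
  IsSheaf := presheaf_isSheaf A

/-- The diagram of the sections over the open neighbourhoods of `x`. -/
abbrev germDiagram (x : CInfPoint A) : (OpenNhds (X := space A) x)ᵒᵖ ⥤ CInfRingCat.{u} :=
  (OpenNhds.inclusion (X := space A) x).op ⋙ presheaf A

/-- The germs at `x` of sections of the structure sheaf, with values in `A_x`. -/
def stalkCocone (x : CInfPoint A) : Limits.Cocone (germDiagram A x) where
  pt := CInfRingCat.of (Germ x)
  ι :=
    { app := fun U => eval (A := A) (U := U.unop.1) ⟨x, U.unop.2⟩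
      naturality := fun _ _ _ => rfl }

/-- The maps in a cocone under the stalk diagram, as maps of `C^∞`-rings. -/
def legHom {x : CInfPoint A} (s : Limits.Cocone (germDiagram A x))
    (U : Opens (CInfPoint A)) (hU : x ∈ U) : CInfHom (Sections U) s.pt :=
  CInfRingCat.toHom (s.ι.app (Opposite.op ⟨U, hU⟩))

theorem legHom_res {x : CInfPoint A} (s : Limits.Cocone (germDiagram A x))
    {U V : Opens (CInfPoint A)} (hV : x ∈ V) (h : V ≤ U) (t : Sections U) :
    legHom A s V hV (res h t) = legHom A s U (h hV) t := by
  have := s.ι.naturality (X := Opposite.op (⟨U, h hV⟩ : OpenNhds (X := space A) x))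
    (Y := Opposite.op (⟨V, hV⟩ : OpenNhds (X := space A) x)) (homOfLE h).op
  exact congrArg (fun φ : CInfRingCat.of (Sections U) ⟶ s.pt => CInfRingCat.toHom φ t) this

theorem legHom_ofElem {x : CInfPoint A} (s : Limits.Cocone (germDiagram A x))
    (a b : A) (h : toGerm x a = toGerm x b) :
    legHom A s ⊤ (Opens.mem_top x) (ofElem ⊤ a) = legHom A s ⊤ (Opens.mem_top x) (ofElem ⊤ b) := by
  obtain ⟨d, hd, h0⟩ := toGerm_eq_iff.1 h
  let U : Opens (CInfPoint A) := ⟨{y | y d ≠ 0}, isOpen_ne_zero d⟩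
  have hxU : x ∈ U := hd
  rw [← legHom_res A s hxU le_top, ← legHom_res A s hxU le_top]
  congr 1
  exact sections_ext fun y => toGerm_eq_iff.2 ⟨d, y.2, h0⟩

theorem legHom_factor {x : CInfPoint A} (s : Limits.Cocone (germDiagram A x))
    (U : Opens (CInfPoint A)) (hU : x ∈ U) (t : Sections U) :
    liftGerm x ((legHom A s ⊤ (Opens.mem_top x)).comp (ofElem ⊤)) (legHom_ofElem A s)
      (eval (⟨x, hU⟩ : U) t) = legHom A s U hU t := by
  obtain ⟨V, hxV, a, ha⟩ := t.2 ⟨x, hU⟩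
  have hW : x ∈ U ⊓ V := ⟨hU, hxV⟩
  have h1 : res (V := U ⊓ V) inf_le_left t = res (U := ⊤) le_top (ofElem ⊤ a) :=
    sections_ext fun y => ha ⟨y.1, y.2.1⟩ y.2.2
  have h3 : eval (⟨x, hU⟩ : U) t = toGerm x a := ha _ hxV
  rw [h3, ← legHom_res A s hW inf_le_left, h1, legHom_res]
  exact liftGerm_toGerm x _ (legHom_ofElem A s) a

/-- The stalk of the structure sheaf at `x` is `A_x`. -/
def stalkIsColimit (x : CInfPoint A) : Limits.IsColimit (stalkCocone A x) where
  desc s := CInfRingCat.ofHom (liftGerm x ((legHom A s ⊤ (Opens.mem_top x)).comp (ofElem ⊤))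
    (legHom_ofElem A s))
  fac s U := CInfHom.ext (funext fun t => legHom_factor A s U.unop.1 U.unop.2 t)
  uniq s m hm := by
    refine CInfHom.ext (funext fun t => ?_)
    obtain ⟨a, rfl⟩ := toGerm_surjective x t
    refine Eq.trans ?_ (liftGerm_toGerm x _ (legHom_ofElem A s) a).symm
    have h := hm (Opposite.op ⟨⊤, Opens.mem_top x⟩)
    exact congrArg (fun φ : CInfRingCat.of (Sections (A := A) ⊤) ⟶ s.pt =>
      CInfRingCat.toHom φ (ofElem ⊤ a)) h

end CInfSpec

/-- The affine `C^∞`-scheme `Spec(A)`. -/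
def CInfSpec (A : Type u) [CInfRing A] : LocalCInfRingedSpace.{u} where
  __ := CInfSpec.sheafedSpace A
  isLocal x := ⟨CInfSpec.stalkCocone A x, ⟨CInfSpec.stalkIsColimit A x⟩,
    CInfPoint.germ_isLocal x⟩

/-- The points of `Spec(A)` are the `ℝ`-points of `A`. -/
theorem CInfSpec_carrier (A : Type u) [CInfRing A] :
    (CInfSpec A).carrier = TopCat.of (CInfPoint A) := rfl

/-! ### Points of `C^∞(M)` and of its quotients -/

/-- Evaluation at a point of `M`, as an `ℝ`-point of `C^∞(M)`. -/
def SmoothFun.evalPoint {E : Type*} [NormedAddCommGroup E] [NormedSpace ℝ E]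
    {H : Type*} [TopologicalSpace H] (I : ModelWithCorners ℝ E H)
    {M : Type*} [TopologicalSpace M] [ChartedSpace H M] (q : M) : CInfPoint (SmoothFun I M) :=
  ⟨fun f => f q, fun _ _ => rfl⟩

/-- The zero set in `ℝⁿ` of an ideal of `C^∞(ℝⁿ)`. -/
def zeroSet {n : ℕ} (J : Ideal (EucFun n)) : Set (Fin n → ℝ) :=
  {p | ∀ j ∈ J, j p = 0}

/-- The ideal `J = ker Π`. -/
def CInfHom.ker {A : Type u} {B : Type v} [CInfRing A] [CInfRing B] (φ : CInfHom A B) : Ideal A :=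
  RingHom.ker φ.toRingHom

/-- For `Π : C^∞(ℝⁿ) → A` surjective with kernel `J` and `p ∈ Z_J`, the `ℝ`-point `Π(h) ↦ h(p)`
of `A`. -/
def zeroSetPoint {A : Type u} [CInfRing A] {n : ℕ} (Pr : CInfHom (EucFun n) A)
    (hPr : Function.Surjective Pr) (p : zeroSet Pr.ker) : CInfPoint A where
  toFun a := (Function.surjInv hPr a) p.1
  map_op' g a := by
    have key : ∀ h k : EucFun n, Pr h = Pr k → h p.1 = k p.1 := by
      intro h k hk
      have h1 : h - k ∈ Pr.ker := by
        change Pr (h - k) = 0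
        rw [map_sub, hk, sub_self]
      exact sub_eq_zero.1 (p.2 _ h1)
    refine key _ (CInfRing.op g fun i => Function.surjInv hPr (a i)) ?_
    rw [CInfHom.map_op, Function.surjInv_eq hPr]
    simp only [Function.surjInv_eq hPr]

theorem zeroSetPoint_apply {A : Type u} [CInfRing A] {n : ℕ} (Pr : CInfHom (EucFun n) A)
    (hPr : Function.Surjective Pr) (p : zeroSet Pr.ker) (h : EucFun n) :
    zeroSetPoint Pr hPr p (Pr h) = h p.1 := by
  have h1 : Function.surjInv hPr (Pr h) - h ∈ Pr.ker := by
    change Pr _ = 0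
    rw [map_sub, Function.surjInv_eq hPr, sub_self]
  exact sub_eq_zero.1 (p.2 _ h1)

end

/-!
An `ℝ`-point of a quotient of `C^∞(ℝⁿ)` is determined by its values on the coordinate functions,
because every smooth function is an operation applied to them (`zeroSetPoint_surjective`). An
`ℝ`-point of `C^∞(L)` is an evaluation by Milnor's compactness argument
(`SmoothFun.evalPoint_surjective`). In both cases the topologies agree because every open set is
the cozero set of a smooth function.

A morphism `F = (φ, φ_#)` between spectra is automatically local: `φ_#` commutes with taking
values of sections at points (`CInfSpec.value_sectionMap`). This has two consequences when the
source is `Spec(C^∞(L))`. The `i`-th coordinate of the map `f` underlying `F` is the function of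
values of the section `φ_#(Π(xᵢ))`, so that `f` is smooth (`CInfSpec.contMDiff_value`). And `φ`
determines `φ_#`, because sections of the structure sheaf of `Spec(C^∞(L))` are determined by their
values (`CInfSpec.hom_ext_of_points`); this is injectivity. For surjectivity, a smooth `f` with
image in `Z_J` satisfies `j ∘ f = 0` for all `j ∈ J`, hence induces a map `A → C^∞(L)`
(`pullbackOfZeroSet`), whose image under the functor `Spec` has `f` as its underlying map.
-/

/-! ### Real points of `C^∞(M)` and of quotients of `C^∞(ℝⁿ)` -/

@[simp] theorem SmoothFun.evalPoint_apply {E : Type*} [NormedAddCommGroup E] [NormedSpace ℝ E]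
    {H : Type*} [TopologicalSpace H] (I : ModelWithCorners ℝ E H)
    {M : Type*} [TopologicalSpace M] [ChartedSpace H M] (q : M) (f : SmoothFun I M) :
    SmoothFun.evalPoint I q f = f q := rfl

/-- A bijection onto `X_A` is a homeomorphism as soon as the cozero sets of the elements of `A`
form a basis of the topology of the source. -/
theorem CInfPoint.isHomeomorph_of_cozero_basis {A : Type u} [CInfRing A] {T : Type*}
    [TopologicalSpace T] (e : T → CInfPoint A) (he : Function.Bijective e)
    (hopen : ∀ a : A, IsOpen {t | e t a ≠ 0})
    (hbasis : ∀ U : Set T, IsOpen U → ∀ q ∈ U, ∃ a : A, e q a ≠ 0 ∧ ∀ t, e t a ≠ 0 → t ∈ U) :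
    IsHomeomorph e := by
  refine ⟨continuous_generateFrom_iff.2 ?_, fun U hU => ?_, he⟩
  · rintro _ ⟨a, rfl⟩
    exact hopen a
  · rw [isOpen_iff_forall_mem_open]
    rintro _ ⟨q, hq, rfl⟩
    obtain ⟨a, ha, haU⟩ := hbasis U hU q hq
    refine ⟨_, fun y hy => ?_, CInfPoint.isOpen_ne_zero a, ha⟩
    obtain ⟨t, rfl⟩ := he.2 y
    exact ⟨t, haU t hy, rfl⟩

theorem SmoothFun.isUnit_of_forall_ne_zero {E : Type*} [NormedAddCommGroup E] [NormedSpace ℝ E]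
    {H : Type*} [TopologicalSpace H] {I : ModelWithCorners ℝ E H}
    {M : Type*} [TopologicalSpace M] [ChartedSpace H M] {f : SmoothFun I M}
    (hf : ∀ q, f q ≠ 0) : IsUnit f := by
  refine IsUnit.of_mul_eq_one ⟨fun q => (f q)⁻¹, f.contMDiff.inv₀ hf⟩ ?_
  ext q
  exact mul_inv_cancel₀ (hf q)

section Manifold

variable {E : Type*} [NormedAddCommGroup E] [NormedSpace ℝ E] [FiniteDimensional ℝ E]
  {H : Type*} [TopologicalSpace H] (I : ModelWithCorners ℝ E H)
  {L : Type*} [TopologicalSpace L] [ChartedSpace H L] [IsManifold I ∞ L]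
  [T2Space L]

/-- A smooth function with compact level sets: one dominating the index function of an exhaustion
by compact sets. -/
theorem SmoothFun.exists_isCompact_levelSets [SigmaCompactSpace L] :
    ∃ h : SmoothFun I L, ∀ c : ℝ, IsCompact {q | h q = c} := by
  have : LocallyCompactSpace L := Manifold.locallyCompact_of_finiteDimensional I
  let K := CompactExhaustion.choice L
  obtain ⟨h, hh⟩ := exists_contMDiffMap_forall_mem_convex_of_local_const (F := ℝ) I (M := L)
    (t := fun q => Set.Ici (K.find q : ℝ)) (n := ⊤) (fun _ => convex_Ici _) (fun q => by
      obtain ⟨m, hm⟩ := K.exists_mem_nhds q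
      refine ⟨m, Filter.mem_of_superset hm fun y hy => ?_⟩
      exact Nat.cast_le (α := ℝ).2 (K.mem_iff_find_le.1 hy))
  refine ⟨h, fun c => ?_⟩
  obtain ⟨m, hm⟩ := exists_nat_ge c
  refine (K.isCompact m).of_isClosed_subset (isClosed_eq h.contMDiff.continuous continuous_const)
    fun q hq => ?_
  refine K.mem_iff_find_le.2 ((Nat.cast_le (α := ℝ)).1 ?_)
  calc (K.find q : ℝ) ≤ h q := hh q
    _ = c := hq
    _ ≤ m := hm

theorem SmoothFun.exists_cozero [SigmaCompactSpace L] {U : Set L} (hU : IsOpen U) :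
    ∃ f : SmoothFun I L, ∀ q, f q ≠ 0 ↔ q ∈ U := by
  obtain ⟨f, hf, hf', -⟩ := hU.exists_contMDiff_support_eq (n := ⊤) I
  exact ⟨⟨f, hf'⟩, fun q => by rw [← hf]; rfl⟩

/-- Every `ℝ`-point of `C^∞(L)` is the evaluation at a point of `L`. Otherwise the functions
`f - x(f)` have no common zero; a sum of squares of finitely many of them, one of which has
compact zero set, is then nowhere zero, hence invertible, although `x` kills it. -/
theorem SmoothFun.evalPoint_surjective [SigmaCompactSpace L] :
    Function.Surjective (SmoothFun.evalPoint I : L → CInfPoint (SmoothFun I L)) := by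
  intro x
  by_contra! hx
  have hsc : ∀ (c : ℝ) (q : L), CInfRing.scalar (SmoothFun I L) c q = c := fun c q =>
    CInfPoint.map_scalar (SmoothFun.evalPoint I q) c
  have h1 : ∀ q : L, ∃ f : SmoothFun I L, x f = 0 ∧ f q ≠ 0 := by
    intro q
    by_contra! hq
    refine hx q (DFunLike.ext _ _ fun f => ?_)
    have := hq (f - CInfRing.scalar _ (x f)) (by rw [map_sub, CInfPoint.map_scalar, sub_self])
    rw [ContMDiffMap.coe_sub, Pi.sub_apply, hsc, sub_eq_zero] at this
    exact this
  choose g hg0 hgq using h1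
  obtain ⟨h, hh⟩ := SmoothFun.exists_isCompact_levelSets I (L := L)
  obtain ⟨t, ht⟩ := (hh (x h)).elim_finite_subcover (fun q => {p | g q p ≠ 0})
    (fun q => isOpen_ne_fun (g q).contMDiff.continuous continuous_const)
    (fun p _ => Set.mem_iUnion.2 ⟨p, hgq p⟩)
  let k : SmoothFun I L := h - CInfRing.scalar _ (x h)
  let s : SmoothFun I L := k * k + ∑ q ∈ t, g q * g q
  have hxs : x s = 0 := by
    simp only [s, k, map_add, map_mul, map_sum, hg0, map_sub, CInfPoint.map_scalar, sub_self,
      mul_zero, Finset.sum_const_zero, add_zero]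
  have hs : ∀ p, s p ≠ 0 := by
    intro p
    have e : s p = (h p - x h) * (h p - x h) + ∑ q ∈ t, g q p * g q p := by
      have := map_add (SmoothFun.evalPoint I p) (k * k) (∑ q ∈ t, g q * g q)
      rw [map_sum] at this
      simp only [map_mul, k, map_sub, CInfPoint.map_scalar] at this
      exact this
    have hsum : 0 ≤ ∑ q ∈ t, g q p * g q p := Finset.sum_nonneg fun q _ => mul_self_nonneg _
    rw [e]
    by_cases hp : h p = x h
    · obtain ⟨q, hq⟩ := Set.mem_iUnion.1 (ht hp)
      obtain ⟨hqt, hqp⟩ := Set.mem_iUnion.1 hq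
      have : 0 < ∑ q ∈ t, g q p * g q p :=
        Finset.sum_pos' (fun q _ => mul_self_nonneg _) ⟨q, hqt, mul_self_pos.2 hqp⟩
      have := mul_self_nonneg (h p - x h)
      linarith
    · have := mul_self_pos.2 (sub_ne_zero.2 hp)
      linarith
  exact ((SmoothFun.isUnit_of_forall_ne_zero hs).map x).ne_zero hxs

theorem SmoothFun.isHomeomorph_evalPoint [SigmaCompactSpace L] :
    IsHomeomorph (SmoothFun.evalPoint I : L → CInfPoint (SmoothFun I L)) := by
  refine CInfPoint.isHomeomorph_of_cozero_basis _
    ⟨fun p q hpq => ?_, SmoothFun.evalPoint_surjective I⟩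
    (fun f => isOpen_ne_fun f.contMDiff.continuous continuous_const) (fun U hU q hq => ?_)
  · by_contra hne
    obtain ⟨f, hf⟩ := SmoothFun.exists_cozero I (isOpen_compl_singleton (x := q))
    exact (hf q).1 (fun h0 => (hf p).2 hne ((congrArg (fun y => y f) hpq).trans h0)) rfl
  · obtain ⟨f, hf⟩ := SmoothFun.exists_cozero I hU
    exact ⟨f, (hf q).2 hq, fun t ht => (hf t).1 ht⟩

end Manifold

/-- `C^∞(ℝⁿ)` is free on the coordinate functions. -/
theorem EucFun.op_coord_eq {n : ℕ} (g : EucFun n) : CInfRing.op g EucFun.coord = g := by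
  ext x
  rfl

theorem CInfHom.apply_eq_op_coord {n : ℕ} {B : Type*} [CInfRing B] (φ : CInfHom (EucFun n) B)
    (g : EucFun n) : φ g = CInfRing.op g fun i => φ (EucFun.coord i) := by
  rw [← CInfHom.map_op, EucFun.op_coord_eq]

section Quotient

variable {A : Type u} [CInfRing A] {n : ℕ} (Pr : CInfHom (EucFun n) A)
  (hPr : Function.Surjective Pr)

/-- The point of `Z_J` corresponding to `x` has coordinates `x(Π(x₁)), …, x(Π(xₙ))`. -/
theorem zeroSetPoint_surjective : Function.Surjective (zeroSetPoint Pr hPr) := by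
  intro x
  have hx : ∀ g : EucFun n, x (Pr g) = g fun i => x (Pr (EucFun.coord i)) := fun g =>
    CInfHom.apply_eq_op_coord (x.comp Pr) g
  refine ⟨⟨fun i => x (Pr (EucFun.coord i)), fun j hj => ?_⟩, DFunLike.ext _ _ fun a => ?_⟩
  · rw [← hx, show Pr j = 0 from hj, map_zero]
  · obtain ⟨g, rfl⟩ := hPr a
    rw [zeroSetPoint_apply, hx]

theorem isHomeomorph_zeroSetPoint : IsHomeomorph (zeroSetPoint Pr hPr) := by
  refine CInfPoint.isHomeomorph_of_cozero_basis _
    ⟨fun p q hpq => Subtype.ext (funext fun i => ?_), zeroSetPoint_surjective Pr hPr⟩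
    (fun a => ?_) (fun U hU q hq => ?_)
  · have := congrArg (fun y => y (Pr (EucFun.coord i))) hpq
    simpa only [zeroSetPoint_apply, EucFun.coord_apply] using this
  · obtain ⟨g, rfl⟩ := hPr a
    simp only [zeroSetPoint_apply]
    exact isOpen_ne_fun (g.contMDiff.continuous.comp continuous_subtype_val) continuous_const
  · obtain ⟨V, hV, rfl⟩ := isOpen_induced_iff.1 hU
    obtain ⟨f, hf, hf', -⟩ := hV.exists_contDiff_support_eq (n := ⊤)
    have hmem : ∀ p : zeroSet Pr.ker,
        zeroSetPoint Pr hPr p (Pr (EucFun.mk f hf')) ≠ 0 ↔ p ∈ Subtype.val ⁻¹' V := fun p => by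
      rw [zeroSetPoint_apply, Set.mem_preimage, ← hf]
      rfl
    exact ⟨Pr (EucFun.mk f hf'), (hmem q).2 hq, fun t ht => (hmem t).1 ht⟩

end Quotient

/-! ### Morphisms between spectra -/

namespace CInfSpec
open CInfRing CInfPoint

section Value

variable {A : Type u} [CInfRing A]

/-- The real value of a section at a point of its domain. -/
noncomputable def value {U : Opens (CInfPoint A)} (x : U) : CInfHom (Sections U) ℝ :=
  (germEval x.1).comp (eval x)

theorem value_of_eval_eq {U : Opens (CInfPoint A)} {x : U} {s : Sections U} {a : A}
    (h : eval x s = toGerm x.1 a) : value x s = x.1 a := by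
  rw [value, CInfHom.comp_apply, h, germEval_toGerm]

theorem value_ofElem {U : Opens (CInfPoint A)} (x : U) (a : A) :
    value x (ofElem U a) = x.1 a :=
  value_of_eval_eq (eval_ofElem x a)

theorem value_res {U V : Opens (CInfPoint A)} (h : V ≤ U) (s : Sections U) (x : V) :
    value x (res h s) = value (⟨x.1, h x.2⟩ : U) s := rfl

/-- A section whose value at `x` is not zero is invertible near `x`. -/
theorem exists_res_mul_eq_one {U : Opens (CInfPoint A)} (x : U) (s : Sections U)
    (hs : value x s ≠ 0) :
    ∃ (V : Opens (CInfPoint A)) (h : V ≤ U), x.1 ∈ V ∧ ∃ t : Sections V, res h s * t = 1 := by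
  obtain ⟨W, hxW, a, ha⟩ := s.2 x
  rw [value_of_eval_eq (ha x hxW)] at hs
  obtain ⟨b', hb'⟩ := (isUnit_toGerm hs).exists_right_inv
  obtain ⟨b, rfl⟩ := toGerm_surjective x.1 b'
  rw [← map_mul, ← map_one (toGerm x.1), toGerm_eq_iff] at hb'
  obtain ⟨d, hd, hd0⟩ := hb'
  let D : Opens (CInfPoint A) := ⟨{y | y d ≠ 0}, isOpen_ne_zero d⟩
  have hVU : U ⊓ W ⊓ D ≤ U := inf_le_left.trans inf_le_left
  refine ⟨U ⊓ W ⊓ D, hVU, ⟨⟨x.2, hxW⟩, hd⟩, ofElem _ b, sections_ext fun y => ?_⟩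
  have hy : eval y (res hVU s) = toGerm y.1 a := ha ⟨y.1, hVU y.2⟩ y.2.1.2
  have hyd : toGerm y.1 (a * b) = toGerm y.1 1 := toGerm_eq_iff.2 ⟨d, y.2.2, hd0⟩
  calc eval y (res hVU s * ofElem _ b) = eval y (res hVU s) * eval y (ofElem _ b) := map_mul _ _ _
    _ = toGerm y.1 a * toGerm y.1 b := by rw [hy, eval_ofElem]
    _ = toGerm y.1 (a * b) := (map_mul _ _ _).symm
    _ = toGerm y.1 1 := hyd
    _ = 1 := map_one _
    _ = eval y 1 := (map_one _).symm

end Value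

section Morphism

variable {A B : Type u} [CInfRing A] [CInfRing B]

/-- The open set `φ⁻¹(U)`, for a morphism `F = (φ, φ_#)`. -/
noncomputable def preimage (F : CInfSpec B ⟶ CInfSpec A) (U : Opens (CInfPoint A)) : Opens (CInfPoint B) :=
  (Opens.map F.hom.hom.base).obj U

/-- The map `φ_#` on the sections over `U`, for a morphism `F = (φ, φ_#)`. -/
noncomputable def sectionMap (F : CInfSpec B ⟶ CInfSpec A) (U : Opens (CInfPoint A)) :
    CInfHom (Sections U) (Sections (preimage F U)) :=
  CInfRingCat.toHom (F.hom.hom.c.app (Opposite.op U))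

theorem sectionMap_res (F : CInfSpec B ⟶ CInfSpec A) {U V : Opens (CInfPoint A)} (h : V ≤ U)
    (s : Sections U) :
    sectionMap F V (res h s) =
      res (U := preimage F U) (V := preimage F V) (fun _ hx => h hx) (sectionMap F U s) := by
  have := F.hom.hom.c.naturality (homOfLE h).op
  exact congrArg (fun φ => CInfRingCat.toHom φ s) this

/-- Morphisms of `C^∞`-ringed spaces are automatically local: `φ_#` commutes with taking values.
After subtraction of a constant, the value of `φ_#(s)` at `x` is zero; if that of `s` at `φ(x)`
were not, `s` would be invertible near `φ(x)`, and so would be `φ_#(s)` near `x`. -/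
theorem value_sectionMap (F : CInfSpec B ⟶ CInfSpec A) (U : Opens (CInfPoint A)) (s : Sections U)
    (x : CInfPoint B) (hx : LocalCInfRingedSpace.points F x ∈ U) :
    value (⟨x, hx⟩ : preimage F U) (sectionMap F U s) =
      value (⟨LocalCInfRingedSpace.points F x, hx⟩ : U) s := by
  set c : ℝ := value (⟨x, hx⟩ : preimage F U) (sectionMap F U s) with hc
  by_contra hne
  let t : Sections U := s - scalar _ c
  have ht0 : value (⟨x, hx⟩ : preimage F U) (sectionMap F U t) = 0 := by
    rw [map_sub, map_sub, CInfHom.map_scalar, CInfPoint.map_scalar, ← hc, sub_self]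
  have ht : value (⟨LocalCInfRingedSpace.points F x, hx⟩ : U) t ≠ 0 := by
    rw [map_sub, CInfPoint.map_scalar]
    exact sub_ne_zero.2 (Ne.symm hne)
  obtain ⟨V, hVU, hxV, r, hr⟩ := exists_res_mul_eq_one _ t ht
  have hres : value (⟨x, hxV⟩ : preimage F V) (sectionMap F V (res hVU t)) = 0 := by
    rw [sectionMap_res]
    exact ht0
  have h1 := congrArg (fun y => value (⟨x, hxV⟩ : preimage F V) (sectionMap F V y)) hr
  simp only [map_mul, map_one, hres, zero_mul] at h1
  exact zero_ne_one h1

/-- The map `A_{x ∘ ψ} → B_x` induced by `ψ : A → B`. -/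
noncomputable def germMap (ψ : CInfHom A B) (x : CInfPoint B) :
    CInfHom (Germ (x.comp ψ)) (Germ x) :=
  liftGerm _ ((toGerm x).comp ψ) fun a b hab => by
    obtain ⟨d, hd, h0⟩ := toGerm_eq_iff.1 hab
    refine toGerm_eq_iff.2 ⟨ψ d, hd, ?_⟩
    rw [← map_sub, ← map_mul, h0, map_zero]

theorem germMap_toGerm (ψ : CInfHom A B) (x : CInfPoint B) (a : A) :
    germMap ψ x (toGerm (x.comp ψ) a) = toGerm x (ψ a) :=
  liftGerm_toGerm _ _ _ a

theorem continuous_comap (ψ : CInfHom A B) :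
    Continuous (fun x : CInfPoint B => (x.comp ψ : CInfPoint A)) := by
  refine continuous_generateFrom_iff.2 ?_
  rintro _ ⟨a, rfl⟩
  exact isOpen_ne_zero (ψ a)

/-- The map of points of `Spec(ψ)`: composition with `ψ`. -/
noncomputable def mapBase (ψ : CInfHom A B) : space B ⟶ space A :=
  TopCat.ofHom ⟨fun x => x.comp ψ, continuous_comap ψ⟩

/-- The open set of the points `x` of `B` with `x ∘ ψ ∈ U`. -/
def comap (ψ : CInfHom A B) (U : Opens (CInfPoint A)) : Opens (CInfPoint B) :=
  ⟨{x | x.comp ψ ∈ U}, U.isOpen.preimage (continuous_comap ψ)⟩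

/-- The map of sections of `Spec(ψ)`: germwise application of `ψ`. -/
noncomputable def mapSections (ψ : CInfHom A B) (U : Opens (CInfPoint A)) :
    CInfHom (Sections U) (Sections (comap ψ U)) where
  toFun s := ⟨fun x => germMap ψ x.1 (s.1 ⟨x.1.comp ψ, x.2⟩), fun x => by
    obtain ⟨V, hxV, a, ha⟩ := s.2 ⟨x.1.comp ψ, x.2⟩
    exact ⟨comap ψ V, hxV, ψ a, fun y hy =>
      (congrArg (germMap ψ y.1) (ha ⟨y.1.comp ψ, y.2⟩ hy)).trans (germMap_toGerm ψ y.1 a)⟩⟩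
  map_op' g s := Subtype.ext (funext fun x => (germMap ψ x.1).map_op g _)

/-- The morphism `Spec(ψ) : Spec(B) ⟶ Spec(A)` induced by `ψ : A → B`. -/
noncomputable def map (ψ : CInfHom A B) : CInfSpec B ⟶ CInfSpec A :=
  InducedCategory.homMk (InducedCategory.homMk
    { base := mapBase ψ
      c :=
        { app := fun U => CInfRingCat.ofHom (mapSections ψ U.unop)
          naturality := fun _ _ _ => rfl } })

theorem points_map (ψ : CInfHom A B) (x : CInfPoint B) :
    LocalCInfRingedSpace.points (map ψ) x = x.comp ψ := rfl

end Morphism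

/-! ### The structure sheaf of the spectrum of `C^∞(L)` -/

section Manifold

variable {E : Type*} [NormedAddCommGroup E] [NormedSpace ℝ E] [FiniteDimensional ℝ E]
  {H : Type*} [TopologicalSpace H] (I : ModelWithCorners ℝ E H)
  {L : Type u} [TopologicalSpace L] [ChartedSpace H L] [IsManifold I ∞ L]
  [T2Space L] [SigmaCompactSpace L]

/-- A section of the structure sheaf of `Spec(C^∞(L))` is a smooth function: it is determined by
its values, since two functions which agree near `q` have the same germ at `ev_q`. -/
theorem sections_ext_of_value {U : Opens (CInfPoint (SmoothFun I L))} {s t : Sections U}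
    (h : ∀ x : U, value x s = value x t) : s = t := by
  have hev := SmoothFun.isHomeomorph_evalPoint I (L := L)
  refine sections_ext fun x => ?_
  obtain ⟨V, hxV, a, ha⟩ := s.2 x
  obtain ⟨W, hxW, b, hb⟩ := t.2 x
  obtain ⟨q, hq⟩ := hev.bijective.2 x.1
  obtain ⟨d, hd⟩ := SmoothFun.exists_cozero I ((U ⊓ V ⊓ W).isOpen.preimage hev.continuous)
  rw [show eval x s = toGerm x.1 a from ha x hxV, show eval x t = toGerm x.1 b from hb x hxW,
    toGerm_eq_iff]
  refine ⟨d, ?_, ?_⟩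
  · rw [← hq]
    refine (hd q).2 ?_
    rw [Set.mem_preimage, hq]
    exact ⟨⟨x.2, hxV⟩, hxW⟩
  · ext p
    change (a p - b p) * d p = 0
    by_cases hp : d p = 0
    · rw [hp, mul_zero]
    · obtain ⟨⟨hU, hV⟩, hW⟩ := (hd p).1 hp
      have := h ⟨_, hU⟩
      rw [value_of_eval_eq (ha ⟨_, hU⟩ hV), value_of_eval_eq (hb ⟨_, hU⟩ hW)] at this
      rw [show a p = b p from this, sub_self, zero_mul]

theorem contMDiff_value {U : Opens (CInfPoint (SmoothFun I L))}
    (hU : ∀ q : L, SmoothFun.evalPoint I q ∈ U) (s : Sections U) :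
    ContMDiff I 𝓘(ℝ, ℝ) ∞ fun q : L => value (⟨SmoothFun.evalPoint I q, hU q⟩ : U) s := by
  have hev := SmoothFun.isHomeomorph_evalPoint I (L := L)
  refine contMDiff_of_locally_contMDiffOn fun q => ?_
  obtain ⟨V, hV, a, ha⟩ := s.2 ⟨_, hU q⟩
  exact ⟨_, V.isOpen.preimage hev.continuous, hV, a.contMDiff.contMDiffOn.congr fun p hp =>
    value_of_eval_eq (ha ⟨_, hU p⟩ hp)⟩

variable {A : Type u} [CInfRing A]

/-- A morphism out of `Spec(C^∞(L))` is determined by its map of points, which determines the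
values of the pulled back sections. -/
theorem hom_ext_of_points (F G : CInfSpec (SmoothFun I L) ⟶ CInfSpec A)
    (h : ∀ x, LocalCInfRingedSpace.points F x = LocalCInfRingedSpace.points G x) : F = G := by
  have key : ∀ (U : Opens (CInfPoint A)) (s : Sections U) (x : CInfPoint (SmoothFun I L))
      (hF : LocalCInfRingedSpace.points F x ∈ U) (hG : LocalCInfRingedSpace.points G x ∈ U),
      value (⟨x, hF⟩ : preimage F U) (sectionMap F U s) =
        value (⟨x, hG⟩ : preimage G U) (sectionMap G U s) := by
    intro U s x hF hG
    rw [value_sectionMap, value_sectionMap]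
    have hpt : (⟨_, hF⟩ : U) = ⟨_, hG⟩ := Subtype.ext (h x)
    rw [hpt]
  obtain ⟨⟨⟨φ, c⟩⟩⟩ := F
  obtain ⟨⟨⟨φ', c'⟩⟩⟩ := G
  obtain rfl : φ = φ' := TopCat.hom_ext (ContinuousMap.ext h)
  have hc : c = c' := by
    refine NatTrans.ext (funext fun U => CInfHom.ext (funext fun s => ?_))
    exact sections_ext_of_value I fun x => key U.unop s x.1 x.2 x.2
  rw [hc]

end Manifold

end CInfSpec

/-! ### Maps into the zero set -/

section ZeroSet

variable {E : Type*} [NormedAddCommGroup E] [NormedSpace ℝ E]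
  {H : Type*} [TopologicalSpace H] {I : ModelWithCorners ℝ E H}
  {L : Type u} [TopologicalSpace L] [ChartedSpace H L]
  {A : Type u} [CInfRing A] {n : ℕ} (Pr : CInfHom (EucFun n) A) (hPr : Function.Surjective Pr)

/-- The map `A → C^∞(L)`, `Π(h) ↦ h ∘ f`, for a smooth map `f : L → ℝⁿ` with image in `Z_J`. -/
noncomputable def pullbackOfZeroSet {f : L → (Fin n → ℝ)} (hf : ContMDiff I 𝓘(ℝ, Fin n → ℝ) ∞ f)
    (hfZ : ∀ q, f q ∈ zeroSet Pr.ker) : CInfHom A (SmoothFun I L) where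
  toFun a := ⟨fun q => zeroSetPoint Pr hPr ⟨f q, hfZ q⟩ a, by
    obtain ⟨g, rfl⟩ := hPr a
    simp only [zeroSetPoint_apply]
    exact g.contMDiff.comp hf⟩
  map_op' g a := by
    ext q
    exact (zeroSetPoint Pr hPr ⟨f q, hfZ q⟩).map_op g a

theorem evalPoint_comp_pullbackOfZeroSet {f : L → (Fin n → ℝ)}
    (hf : ContMDiff I 𝓘(ℝ, Fin n → ℝ) ∞ f) (hfZ : ∀ q, f q ∈ zeroSet Pr.ker) (q : L) :
    (SmoothFun.evalPoint I q).comp (pullbackOfZeroSet Pr hPr hf hfZ) =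
      zeroSetPoint Pr hPr ⟨f q, hfZ q⟩ := rfl

end ZeroSet

theorem mainTheorem4
    -- a smooth finite-dimensional manifold `L`, possibly with boundary
    {E : Type v} [NormedAddCommGroup E] [NormedSpace ℝ E] [FiniteDimensional ℝ E]
    {H : Type w} [TopologicalSpace H] (I : ModelWithCorners ℝ E H)
    (L : Type u) [TopologicalSpace L] [ChartedSpace H L] [IsManifold I ∞ L]
    [T2Space L] [SecondCountableTopology L]
    -- a finitely generated and germ determined `C^∞`-ring with a choice of generators
    (A : Type u) [CInfRing A] (hA : CInfRing.GermDetermined A)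
    (n : ℕ) (Pr : CInfHom (EucFun n) A) (hPr : Function.Surjective Pr) :
    -- the identifications of `L` and `Z_J` with the `ℝ`-points of `C^∞(L)` and of `A`
    IsHomeomorph (SmoothFun.evalPoint I : L → CInfPoint (SmoothFun I L)) ∧
    IsHomeomorph (zeroSetPoint Pr hPr) ∧
    -- the bijection sending a morphism to its underlying map of points
    ∃ Ψ : (CInfSpec (SmoothFun I L) ⟶ CInfSpec A) →
        {f : L → (Fin n → ℝ) //
          ContMDiff I 𝓘(ℝ, Fin n → ℝ) ∞ f ∧ ∀ q, f q ∈ zeroSet Pr.ker},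
      (∀ F q, LocalCInfRingedSpace.points F (SmoothFun.evalPoint I q) =
        zeroSetPoint Pr hPr ⟨(Ψ F).1 q, (Ψ F).2.2 q⟩) ∧
      Function.Bijective Ψ := by
  have : LocallyCompactSpace L := Manifold.locallyCompact_of_finiteDimensional I
  have hev := SmoothFun.isHomeomorph_evalPoint I (L := L)
  have hzero := isHomeomorph_zeroSetPoint Pr hPr
  choose z hz using hzero.bijective.2
  have hsmooth : ∀ F : CInfSpec (SmoothFun I L) ⟶ CInfSpec A,
      ContMDiff I 𝓘(ℝ, Fin n → ℝ) ∞ fun q : L =>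
        (z (LocalCInfRingedSpace.points F (SmoothFun.evalPoint I q))).1 := by
    intro F
    refine contMDiff_pi_space.2 fun i => ?_
    -- the `i`-th coordinate is the function given by the section `φ_#(Π(xᵢ))`
    refine (CInfSpec.contMDiff_value I (U := CInfSpec.preimage F ⊤) (fun _ => trivial)
      (CInfSpec.sectionMap F ⊤ (CInfSpec.ofElem ⊤ (Pr (EucFun.coord i))))).congr fun q => ?_
    refine Eq.trans ?_ (CInfSpec.value_sectionMap F ⊤ _ (SmoothFun.evalPoint I q) trivial).symm
    rw [CInfSpec.value_ofElem]
    refine Eq.trans ?_ (congrArg (fun y : CInfPoint A => y (Pr (EucFun.coord i))) (hz _))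
    exact (zeroSetPoint_apply Pr hPr _ (EucFun.coord i)).symm
  let Ψ : (CInfSpec (SmoothFun I L) ⟶ CInfSpec A) →
      {f : L → (Fin n → ℝ) //
        ContMDiff I 𝓘(ℝ, Fin n → ℝ) ∞ f ∧ ∀ q, f q ∈ zeroSet Pr.ker} :=
    fun F => ⟨_, hsmooth F, fun q => Subtype.property _⟩
  have hΨ : ∀ F q, LocalCInfRingedSpace.points F (SmoothFun.evalPoint I q) =
      zeroSetPoint Pr hPr ⟨(Ψ F).1 q, (Ψ F).2.2 q⟩ := fun F q => (hz _).symm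
  refine ⟨hev, hzero, Ψ, hΨ, fun F G hFG => ?_, fun f => ?_⟩
  · refine CInfSpec.hom_ext_of_points I F G fun x => ?_
    obtain ⟨q, rfl⟩ := hev.bijective.2 x
    exact ((hΨ F q).trans (congrArg (zeroSetPoint Pr hPr)
      (Subtype.ext (congrFun (congrArg Subtype.val hFG) q)))).trans (hΨ G q).symm
  · refine ⟨CInfSpec.map (pullbackOfZeroSet Pr hPr f.2.1 f.2.2), Subtype.ext (funext fun q => ?_)⟩
    have h1 := hΨ (CInfSpec.map (pullbackOfZeroSet Pr hPr f.2.1 f.2.2)) q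
    rw [CInfSpec.points_map, evalPoint_comp_pullbackOfZeroSet] at h1
    exact (congrArg Subtype.val (hzero.bijective.1 h1)).symm
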